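/- Let $G$ be a finite group and let $H$ be a proper, non-trivial subgroup of $G$ which is malnormal, i.e. $H\cap gHg^{-1}=\{e\}$ for all $g\in G\setminus H$ (so $G$ is a Frobenius group with Frobenius complement $H$). Let $K=\left(G\setminus\bigcup_{g\in G}gHg^{-1}\right)\cup\{e\}$ be the corresponding Frobenius kernel. Suppose that $H$ is abelian and that the elements of $K$ commute with each other, and put $h=|H|$ and $k=|K|$. Let $A=\mathrm{Z}\ell^1(G)$ be the centre of the complex group algebra $\ell^1(G)$, with the norm $\|f\|=\sum_{x\in G}|f(x)|$. A diagonal element of $A$ is an $M\in A\otimes A$ such that $a\cdot M=M\cdot a$ for all $a\in A$, where $a\cdot(b\otimes c)=ab\otimes c$ and $(b\otimes c)\cdot a=b\otimes ca$, and such that the product map $A\otimes A\to A$ sends $M$ to $1_A$. Let $\mathrm{AM}_{\mathrm Z}(G)$ be the amenability constant of $A$, i.e. the norm of its (unique) diagonal element in the projective tensor product $A\mathbin{\widehat\otimes}A$. Then $$\mathrm{AM}_{\mathrm Z}(G)=1+2\cdot\frac{h^2-1}{h}\left(1-\frac{h-1}{k}\right)\left(1-\frac1k\right).$$ -/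

import Mathlib

open scoped TensorProduct

/-- A proper, non-trivial, malnormal subgroup: `H ∩ gHg⁻¹ = {1}` for every `g ∈ G \ H`.
A finite group is a Frobenius group when it has such a subgroup. -/
structure IsFrobeniusComplement {G : Type*} [Group G] (H : Subgroup G) : Prop where
  ne_bot : H ≠ ⊥
  ne_top : H ≠ ⊤
  malnormal : ∀ g : G, g ∉ H → ∀ x ∈ H, g * x * g⁻¹ ∈ H → x = 1

/-- The Frobenius kernel `(G \ ⋃ g, gHg⁻¹) ∪ {1}` attached to `H`, as a subset of `G`. -/
def frobeniusKernel {G : Type*} [Group G] (H : Subgroup G) : Set G :=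
  {x | ∀ g : G, ∀ y ∈ H, x ≠ g * y * g⁻¹} ∪ {1}

/-- The projective tensor norm on `A ⊗ A` built from a norm `N` on `A`: the infimum of
`∑ i, N (a i) * N (b i)` over all finite representations `t = ∑ i, a i ⊗ b i`. -/
noncomputable def projectiveNorm {A : Type*} [AddCommGroup A] [Module ℂ A] (N : A → ℝ)
    (t : A ⊗[ℂ] A) : ℝ :=
  sInf {r : ℝ | ∃ (n : ℕ) (a b : Fin n → A),
    t = ∑ i, a i ⊗ₜ[ℂ] b i ∧ r = ∑ i, N (a i) * N (b i)}

/-- `M ∈ A ⊗ A` is a diagonal element: `a · M = M · a` for all `a`, where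
`a · (b ⊗ c) = ab ⊗ c` and `(b ⊗ c) · a = b ⊗ ca`, and the product map sends `M` to `1`. -/
structure IsDiagonalElement {A : Type*} [Ring A] [Algebra ℂ A] (M : A ⊗[ℂ] A) : Prop where
  comm : ∀ a : A, (a ⊗ₜ[ℂ] (1 : A)) * M = M * ((1 : A) ⊗ₜ[ℂ] a)
  mul_eq_one : LinearMap.mul' ℂ A M = 1

/-- A commutative algebra has at most one diagonal element. -/
theorem IsDiagonalElement.unique {A : Type*} [CommRing A] [Algebra ℂ A] {M M' : A ⊗[ℂ] A}
    (hM : IsDiagonalElement M) (hM' : IsDiagonalElement M') : M = M' := by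
  have key : ∀ (P : A ⊗[ℂ] A), IsDiagonalElement P → ∀ t : A ⊗[ℂ] A,
      t * P = ((LinearMap.mul' ℂ A t) ⊗ₜ[ℂ] (1 : A)) * P := by
    intro P hP t
    induction t with
    | zero => simp
    | add x y hx hy => rw [add_mul, hx, hy, map_add, TensorProduct.add_tmul, add_mul]
    | tmul a b =>
      have h1 : a ⊗ₜ[ℂ] b = (a ⊗ₜ[ℂ] (1 : A)) * ((1 : A) ⊗ₜ[ℂ] b) := by simp
      rw [h1, mul_assoc, mul_comm ((1 : A) ⊗ₜ[ℂ] b) P, ← hP.comm b, ← mul_assoc]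
      simp
  have h1 := key M hM M'
  have h2 := key M' hM' M
  rw [hM'.mul_eq_one, ← Algebra.TensorProduct.one_def, one_mul] at h1
  rw [hM.mul_eq_one, ← Algebra.TensorProduct.one_def, one_mul] at h2
  rw [← h1, mul_comm, h2]

/-- The amenability constant, with respect to the norm `N`, of a finite-dimensional algebra `A`:
the infimum of the projective norms of its diagonal elements. If `A` is commutative there is at
most one diagonal element, so for an amenable `A` this is the norm of the diagonal element. -/
noncomputable def amenabilityConstant {A : Type*} [Ring A] [Algebra ℂ A] (N : A → ℝ) : ℝ :=
  sInf (projectiveNorm N '' {M : A ⊗[ℂ] A | IsDiagonalElement M})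

/-- The `ℓ¹`-norm `∑ x, |f x|` on the complex group algebra (counting measure on `G`). -/
noncomputable def l1Norm {G : Type*} [Group G] (f : MonoidAlgebra ℂ G) : ℝ :=
  f.coeff.sum fun _ c => ‖c‖

/-- The `ZL`-amenability constant of a finite group `G`: the amenability constant of the centre
of the group algebra `ℓ¹(G)`, normed by the restriction of the `ℓ¹`-norm. -/
noncomputable def amzl (G : Type*) [Group G] : ℝ :=
  amenabilityConstant (A := Subalgebra.center ℂ (MonoidAlgebra ℂ G))
    fun f => l1Norm (f : MonoidAlgebra ℂ G)

/-! ### The centre of the group algebra: tensor coefficients, projective norm, diagonal elements. -/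

section CentreOfGroupAlgebra

variable {G : Type*} [Group G]

/-! The diagonal element of the centre is `∑ χ, e_χ ⊗ e_χ`, with coefficients `|G|⁻² ∑ χ, χ(1)² χ(x)
χ(y)`. Here the irreducible characters are the `h` linear ones, trivial on the kernel `K`, and
others of degree `h`. Since `∑ χ, χ(x) χ(y)` counts the `g` with `g y g⁻¹ = x⁻¹`, the coefficient is
`(h² c(x, y) - (h² - 1) h [xy ∈ K]) / |G|²`, where `c` is `conjugatorCount`. This only motivates
`frobeniusDiagonalCoeff`: the proof checks the diagonal identities by counting, without characters,
and uniqueness of the diagonal does the rest.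

The projective norm is the `ℓ¹`-norm of the coefficients on `G × G`
(`projectiveNorm_center_eq_sum`). The coefficient is nonnegative when `x⁻¹` and `y` are conjugate
and nonpositive otherwise (`abs_frobeniusDiagonalCoeff`), so the norm reduces to three counts: total
conjugators, pairs with `xy ∈ K`, and conjugate pairs.

The group theory comes from the transfer `φ : G → H`. It is a retraction whose kernel is `K`, and
that kernel acts simply transitively by conjugation on each of its other cosets
(`existsUnique_conj`). -/

/-- The elements of `Z ⊗ Z`, for `Z` the centre of the group algebra, as functions on `G × G`. -/
noncomputable def centerTensorCoeff :
    (Subalgebra.center ℂ (MonoidAlgebra ℂ G)) ⊗[ℂ] (Subalgebra.center ℂ (MonoidAlgebra ℂ G))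
      →ₗ[ℂ] (G × G →₀ ℂ) :=
  (finsuppTensorFinsupp' ℂ G G).toLinearMap ∘ₗ
    TensorProduct.map
      ((MonoidAlgebra.coeffLinearEquiv ℂ).toLinearMap ∘ₗ
        (Subalgebra.center ℂ (MonoidAlgebra ℂ G)).val.toLinearMap)
      ((MonoidAlgebra.coeffLinearEquiv ℂ).toLinearMap ∘ₗ
        (Subalgebra.center ℂ (MonoidAlgebra ℂ G)).val.toLinearMap)

theorem centerTensorCoeff_tmul (a b : Subalgebra.center ℂ (MonoidAlgebra ℂ G)) (x y : G) :
    centerTensorCoeff (a ⊗ₜ[ℂ] b) (x, y) =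
      (a : MonoidAlgebra ℂ G).coeff x * (b : MonoidAlgebra ℂ G).coeff y := by
  simp only [centerTensorCoeff, LinearMap.comp_apply, TensorProduct.map_tmul,
    LinearEquiv.coe_coe]
  exact finsuppTensorFinsupp'_apply_apply ℂ G G (a : MonoidAlgebra ℂ G).coeff
    (b : MonoidAlgebra ℂ G).coeff x y

/-- Over a field, tensoring preserves injectivity, so identities in `Z ⊗ Z` can be checked on
coefficients. -/
theorem centerTensorCoeff_injective : Function.Injective (centerTensorCoeff (G := G)) := by
  have hinj : Function.Injective ((MonoidAlgebra.coeffLinearEquiv (M := G) (S := ℂ) ℂ).toLinearMap ∘ₗ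
        (Subalgebra.center ℂ (MonoidAlgebra ℂ G)).val.toLinearMap) := by
    rw [LinearMap.coe_comp]
    exact (MonoidAlgebra.coeffLinearEquiv (M := G) (S := ℂ) ℂ).injective.comp
      Subtype.val_injective
  rw [centerTensorCoeff, LinearMap.coe_comp]
  exact (finsuppTensorFinsupp' ℂ G G).injective.comp
    (TensorProduct.map_injective_of_flat_flat _ _ hinj hinj)

theorem coeff_conj_of_mem_center (a : Subalgebra.center ℂ (MonoidAlgebra ℂ G)) (g x : G) :
    (a : MonoidAlgebra ℂ G).coeff (g * x * g⁻¹) = (a : MonoidAlgebra ℂ G).coeff x := by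
  have h := (Subalgebra.mem_center_iff.1 a.2) (MonoidAlgebra.single g 1)
  have h2 := congrArg (fun f : MonoidAlgebra ℂ G => f.coeff (g * x)) h
  simpa [MonoidAlgebra.coeff_single_mul_apply, MonoidAlgebra.coeff_mul_single_apply] using h2.symm

theorem centerTensorCoeff_conj
    (t : (Subalgebra.center ℂ (MonoidAlgebra ℂ G)) ⊗[ℂ] (Subalgebra.center ℂ (MonoidAlgebra ℂ G)))
    (g g' x y : G) :
    centerTensorCoeff t (g * x * g⁻¹, g' * y * g'⁻¹) = centerTensorCoeff t (x, y) := by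
  induction t with
  | zero => simp
  | add s t hs ht => simp [hs, ht]
  | tmul a b => simp only [centerTensorCoeff_tmul, coeff_conj_of_mem_center]

variable [Fintype G]

theorem l1Norm_eq_sum (f : MonoidAlgebra ℂ G) : l1Norm f = ∑ x, ‖f.coeff x‖ :=
  Finsupp.sum_fintype _ _ (by simp)

theorem MonoidAlgebra.coeff_mul_eq_sum (f g : MonoidAlgebra ℂ G) (w : G) :
    (f * g).coeff w = ∑ x, f.coeff x * g.coeff (x⁻¹ * w) := by
  rw [MonoidAlgebra.coeff_mul_apply_left]
  exact Finsupp.sum_fintype _ _ (by simp)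

theorem MonoidAlgebra.coeff_mul_eq_sum' (f g : MonoidAlgebra ℂ G) (w : G) :
    (f * g).coeff w = ∑ x, f.coeff (w * x⁻¹) * g.coeff x := by
  rw [MonoidAlgebra.coeff_mul_apply_right]
  exact Finsupp.sum_fintype _ _ (by simp)

/-- The average of the conjugates of `x`. -/
noncomputable def classAverage (x : G) : Subalgebra.center ℂ (MonoidAlgebra ℂ G) :=
  ⟨(Fintype.card G : ℂ)⁻¹ • ∑ g : G, MonoidAlgebra.single (g * x * g⁻¹) 1, by
    refine Subalgebra.smul_mem _ ?_ _
    rw [Subalgebra.mem_center_iff]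
    intro b
    induction b using MonoidAlgebra.induction_linear with
    | zero => simp
    | add f g hf hg => rw [add_mul, mul_add, hf, hg]
    | single z c =>
      rw [Finset.mul_sum, Finset.sum_mul]
      refine Fintype.sum_equiv (Equiv.mulLeft z) _ _ fun g => ?_
      simp [MonoidAlgebra.single_mul_single, mul_assoc]⟩

theorem coeff_classAverage [DecidableEq G] (x u : G) :
    (classAverage x : MonoidAlgebra ℂ G).coeff u =
      (Fintype.card G : ℂ)⁻¹ * ∑ g : G, if g⁻¹ * u * g = x then 1 else 0 := by
  have h : ∀ g : G, g * x * g⁻¹ = u ↔ g⁻¹ * u * g = x := fun g => by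
    constructor
    · rintro rfl; group
    · rintro rfl; group
  simp [classAverage, Finsupp.single_apply, h]

theorem l1Norm_classAverage_le (x : G) :
    l1Norm (classAverage x : MonoidAlgebra ℂ G) ≤ 1 := by
  classical
  have hG : (Fintype.card G : ℝ) ≠ 0 := by exact_mod_cast Fintype.card_ne_zero
  rw [l1Norm_eq_sum]
  have h : ∀ u : G, ‖(classAverage x : MonoidAlgebra ℂ G).coeff u‖ ≤
      (Fintype.card G : ℝ)⁻¹ * ∑ g : G, if g⁻¹ * u * g = x then 1 else 0 := fun u => by
    rw [coeff_classAverage, norm_mul, norm_inv, Complex.norm_natCast]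
    gcongr
    refine (norm_sum_le _ _).trans (Finset.sum_le_sum fun g _ => ?_)
    split_ifs <;> simp
  refine (Finset.sum_le_sum fun u _ => h u).trans ?_
  rw [← Finset.mul_sum, Finset.sum_comm]
  have h1 : ∀ g : G, (∑ u : G, if g⁻¹ * u * g = x then (1 : ℝ) else 0) = 1 := fun g => by
    rw [Finset.sum_eq_single (g * x * g⁻¹)]
    · simp [mul_assoc]
    · intro u _ hu
      rw [if_neg]
      rintro rfl
      exact hu (by group)
    · simp
  simp [h1, hG]

/-- The element of `Z ⊗ Z` with prescribed coefficients, when these are class functions. -/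
noncomputable def centerTensorOfCoeff (m : G → G → ℂ) :
    (Subalgebra.center ℂ (MonoidAlgebra ℂ G)) ⊗[ℂ] (Subalgebra.center ℂ (MonoidAlgebra ℂ G)) :=
  ∑ p : G × G, (m p.1 p.2 • classAverage p.1) ⊗ₜ[ℂ] classAverage p.2

theorem centerTensorCoeff_centerTensorOfCoeff {m : G → G → ℂ}
    (hm : ∀ g g' x y, m (g * x * g⁻¹) (g' * y * g'⁻¹) = m x y) (u v : G) :
    centerTensorCoeff (centerTensorOfCoeff m) (u, v) = m u v := by
  classical
  have hG : (Fintype.card G : ℂ) ≠ 0 := by exact_mod_cast Fintype.card_ne_zero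
  have hm' : ∀ g g', m (g⁻¹ * u * g) (g'⁻¹ * v * g') = m u v := fun g g' => by
    simpa using hm g⁻¹ g'⁻¹ u v
  have key : ∀ p : G × G,
      centerTensorCoeff ((m p.1 p.2 • classAverage p.1) ⊗ₜ[ℂ] classAverage p.2) (u, v) =
      (Fintype.card G : ℂ)⁻¹ * (Fintype.card G : ℂ)⁻¹ * ∑ g : G, ∑ g' : G,
        if p = (g⁻¹ * u * g, g'⁻¹ * v * g') then m p.1 p.2 else 0 := by
    rintro ⟨x, y⟩
    rw [centerTensorCoeff_tmul]
    have : ((m x y • classAverage x : Subalgebra.center ℂ (MonoidAlgebra ℂ G)) :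
        MonoidAlgebra ℂ G).coeff u = m x y * (classAverage x : MonoidAlgebra ℂ G).coeff u := rfl
    rw [this, coeff_classAverage, coeff_classAverage]
    have h2 : ∀ g g' : G, (if (x, y) = (g⁻¹ * u * g, g'⁻¹ * v * g') then m x y else 0) =
        m x y * ((if g⁻¹ * u * g = x then 1 else 0) * (if g'⁻¹ * v * g' = y then 1 else 0)) := by
      intro g g'
      simp only [Prod.mk.injEq, eq_comm (a := x), eq_comm (a := y)]
      split_ifs <;> simp_all
    simp_rw [h2, ← Finset.mul_sum, ← Finset.sum_mul]
    ring
  rw [centerTensorOfCoeff, map_sum, Finsupp.finsetSum_apply]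
  simp_rw [key]
  rw [← Finset.mul_sum, Finset.sum_comm]
  simp_rw [Finset.sum_comm (s := (Finset.univ : Finset (G × G)))]
  simp [hm']
  field_simp

/-- On the centre of the group algebra, the projective norm is the `ℓ¹`-norm of `ℓ¹(G × G)`. -/
theorem projectiveNorm_center_eq_sum
    (t : (Subalgebra.center ℂ (MonoidAlgebra ℂ G)) ⊗[ℂ]
      (Subalgebra.center ℂ (MonoidAlgebra ℂ G))) :
    projectiveNorm (fun f : Subalgebra.center ℂ (MonoidAlgebra ℂ G) =>
      l1Norm (f : MonoidAlgebra ℂ G)) t = ∑ p : G × G, ‖centerTensorCoeff t p‖ := by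
  have hlow : ∀ r ∈ {r : ℝ | ∃ (n : ℕ) (a b : Fin n → Subalgebra.center ℂ (MonoidAlgebra ℂ G)),
      t = ∑ i, a i ⊗ₜ[ℂ] b i ∧
        r = ∑ i, l1Norm (a i : MonoidAlgebra ℂ G) * l1Norm (b i : MonoidAlgebra ℂ G)},
      ∑ p : G × G, ‖centerTensorCoeff t p‖ ≤ r := by
    rintro r ⟨n, a, b, rfl, rfl⟩
    calc ∑ p : G × G, ‖centerTensorCoeff (∑ i, a i ⊗ₜ[ℂ] b i) p‖
        ≤ ∑ p : G × G, ∑ i, ‖centerTensorCoeff (a i ⊗ₜ[ℂ] b i) p‖ := by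
          refine Finset.sum_le_sum fun p _ => ?_
          rw [map_sum, Finsupp.finsetSum_apply]
          exact norm_sum_le _ _
      _ = ∑ i, ∑ p : G × G, ‖centerTensorCoeff (a i ⊗ₜ[ℂ] b i) p‖ := Finset.sum_comm
      _ = _ := by
          refine Finset.sum_congr rfl fun i _ => ?_
          rw [l1Norm_eq_sum, l1Norm_eq_sum, Finset.sum_mul_sum, ← Finset.univ_product_univ,
            Finset.sum_product]
          simp_rw [centerTensorCoeff_tmul, norm_mul]
  -- Expanding `t` in class averages, each of norm at most 1, attains the lower bound `hlow`.
  have hrep : t = centerTensorOfCoeff fun x y => centerTensorCoeff t (x, y) := by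
    apply centerTensorCoeff_injective
    ext ⟨u, v⟩
    rw [centerTensorCoeff_centerTensorOfCoeff fun g g' x y => centerTensorCoeff_conj t g g' x y]
  let e := Fintype.equivFin (G × G)
  have hmem : ∑ p : G × G,
      l1Norm ((centerTensorCoeff t p • classAverage p.1 :
        Subalgebra.center ℂ (MonoidAlgebra ℂ G)) : MonoidAlgebra ℂ G) *
        l1Norm (classAverage p.2 : MonoidAlgebra ℂ G) ∈
      {r : ℝ | ∃ (n : ℕ) (a b : Fin n → Subalgebra.center ℂ (MonoidAlgebra ℂ G)),
      t = ∑ i, a i ⊗ₜ[ℂ] b i ∧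
        r = ∑ i, l1Norm (a i : MonoidAlgebra ℂ G) * l1Norm (b i : MonoidAlgebra ℂ G)} := by
    refine ⟨_, fun i => centerTensorCoeff t (e.symm i) • classAverage (e.symm i).1,
      fun i => classAverage (e.symm i).2, ?_, ?_⟩
    · conv_lhs => rw [hrep]
      exact Fintype.sum_equiv e _ _ fun p => by simp
    · exact Fintype.sum_equiv e _ _ fun p => by simp
  refine le_antisymm ((csInf_le ⟨_, fun r hr => hlow r hr⟩ hmem).trans ?_)
    (le_csInf ⟨_, hmem⟩ hlow)
  refine Finset.sum_le_sum fun p _ => ?_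
  have hnn : ∀ f : MonoidAlgebra ℂ G, 0 ≤ l1Norm f := fun f => by
    rw [l1Norm_eq_sum]; positivity
  have hs : l1Norm ((centerTensorCoeff t p • classAverage p.1 :
      Subalgebra.center ℂ (MonoidAlgebra ℂ G)) : MonoidAlgebra ℂ G) =
      ‖centerTensorCoeff t p‖ * l1Norm (classAverage p.1 : MonoidAlgebra ℂ G) := by
    rw [l1Norm_eq_sum, l1Norm_eq_sum, Finset.mul_sum]
    refine Finset.sum_congr rfl fun x _ => ?_
    rw [← norm_mul]
    rfl
  rw [hs, mul_assoc]
  exact mul_le_of_le_one_right (norm_nonneg _)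
    (mul_le_one₀ (l1Norm_classAverage_le _) (hnn _) (l1Norm_classAverage_le _))

theorem centerTensorCoeff_tmul_one_mul (a : Subalgebra.center ℂ (MonoidAlgebra ℂ G))
    (t : (Subalgebra.center ℂ (MonoidAlgebra ℂ G)) ⊗[ℂ]
      (Subalgebra.center ℂ (MonoidAlgebra ℂ G))) (u v : G) :
    centerTensorCoeff ((a ⊗ₜ[ℂ] 1) * t) (u, v) =
      ∑ z, (a : MonoidAlgebra ℂ G).coeff z * centerTensorCoeff t (z⁻¹ * u, v) := by
  induction t with
  | zero => simp
  | add s t hs ht => simp [mul_add, hs, ht, Finset.sum_add_distrib]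
  | tmul b c =>
    rw [Algebra.TensorProduct.tmul_mul_tmul, centerTensorCoeff_tmul, one_mul, MulMemClass.coe_mul,
      MonoidAlgebra.coeff_mul_eq_sum, Finset.sum_mul]
    simp_rw [centerTensorCoeff_tmul, mul_assoc]

theorem centerTensorCoeff_mul_one_tmul (a : Subalgebra.center ℂ (MonoidAlgebra ℂ G))
    (t : (Subalgebra.center ℂ (MonoidAlgebra ℂ G)) ⊗[ℂ]
      (Subalgebra.center ℂ (MonoidAlgebra ℂ G))) (u v : G) :
    centerTensorCoeff (t * (1 ⊗ₜ[ℂ] a)) (u, v) =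
      ∑ z, (a : MonoidAlgebra ℂ G).coeff z * centerTensorCoeff t (u, v * z⁻¹) := by
  induction t with
  | zero => simp
  | add s t hs ht => simp [add_mul, mul_add, hs, ht, Finset.sum_add_distrib]
  | tmul b c =>
    rw [Algebra.TensorProduct.tmul_mul_tmul, centerTensorCoeff_tmul, mul_one, MulMemClass.coe_mul,
      MonoidAlgebra.coeff_mul_eq_sum', Finset.mul_sum]
    refine Finset.sum_congr rfl fun z _ => ?_
    rw [centerTensorCoeff_tmul]
    ring

theorem coeff_mul'_center
    (t : (Subalgebra.center ℂ (MonoidAlgebra ℂ G)) ⊗[ℂ]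
      (Subalgebra.center ℂ (MonoidAlgebra ℂ G))) (w : G) :
    (LinearMap.mul' ℂ (Subalgebra.center ℂ (MonoidAlgebra ℂ G)) t : MonoidAlgebra ℂ G).coeff w =
      ∑ x, centerTensorCoeff t (x, x⁻¹ * w) := by
  induction t with
  | zero => simp
  | add s t hs ht => simp [hs, ht, Finset.sum_add_distrib]
  | tmul b c =>
    rw [LinearMap.mul'_apply, MulMemClass.coe_mul, MonoidAlgebra.coeff_mul_eq_sum]
    simp_rw [centerTensorCoeff_tmul]

theorem isDiagonalElement_of_coeff [DecidableEq G]
    {t : (Subalgebra.center ℂ (MonoidAlgebra ℂ G)) ⊗[ℂ]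
      (Subalgebra.center ℂ (MonoidAlgebra ℂ G))}
    (hcomm : ∀ (a : Subalgebra.center ℂ (MonoidAlgebra ℂ G)) (u v : G),
      ∑ z, (a : MonoidAlgebra ℂ G).coeff z * centerTensorCoeff t (z⁻¹ * u, v) =
        ∑ z, (a : MonoidAlgebra ℂ G).coeff z * centerTensorCoeff t (u, v * z⁻¹))
    (hmul : ∀ w, ∑ x, centerTensorCoeff t (x, x⁻¹ * w) = if w = 1 then 1 else 0) :
    IsDiagonalElement t where
  comm a := by
    apply centerTensorCoeff_injective
    ext ⟨u, v⟩
    rw [centerTensorCoeff_tmul_one_mul, centerTensorCoeff_mul_one_tmul, hcomm]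
  mul_eq_one := by
    apply Subtype.ext
    apply MonoidAlgebra.ext
    ext w
    rw [coeff_mul'_center, hmul, OneMemClass.coe_one, MonoidAlgebra.one_def,
      MonoidAlgebra.coeff_single, Finsupp.single_apply]
    simp [eq_comm]

theorem amzl_eq_sum_of_isDiagonalElement
    {t : (Subalgebra.center ℂ (MonoidAlgebra ℂ G)) ⊗[ℂ]
      (Subalgebra.center ℂ (MonoidAlgebra ℂ G))} (ht : IsDiagonalElement t) :
    amzl G = ∑ p : G × G, ‖centerTensorCoeff t p‖ := by
  have h : {M : (Subalgebra.center ℂ (MonoidAlgebra ℂ G)) ⊗[ℂ]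
      (Subalgebra.center ℂ (MonoidAlgebra ℂ G)) | IsDiagonalElement M} = {t} := by
    ext M
    exact ⟨fun hM => IsDiagonalElement.unique hM ht, fun hM => by rw [Set.mem_singleton_iff.1 hM]; exact ht⟩
  rw [amzl, amenabilityConstant, h, Set.image_singleton, csInf_singleton,
    projectiveNorm_center_eq_sum]

end CentreOfGroupAlgebra

/-! ### Frobenius groups with abelian complement: the kernel and conjugacy classes. -/

section FrobeniusGroups

variable {G : Type*} [Group G]

/-- The transfer to an abelian Frobenius complement is a retraction. -/
theorem IsFrobeniusComplement.exists_retraction [Finite G] {H : Subgroup G}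
    (hH : IsFrobeniusComplement H) (hHcomm : ∀ x ∈ H, ∀ y ∈ H, x * y = y * x) :
    ∃ φ : G →* H, ∀ q : H, φ q = q := by
  classical
  let _ : CommGroup H :=
    { (inferInstance : Group H) with
      mul_comm := fun a b => Subtype.ext (hHcomm a a.2 b b.2) }
  refine ⟨MonoidHom.transfer (MonoidHom.id H), fun q => ?_⟩
  have : Fintype (Quotient (MulAction.orbitRel (Subgroup.zpowers (q : G)) (G ⧸ H))) :=
    Fintype.ofFinite _
  have hone : ∀ r : G, r ∈ H → (r : G ⧸ H) = ((1 : G) : G ⧸ H) := fun r hr => by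
    rw [eq_comm, QuotientGroup.eq]; simpa using hr
  have hfix : (q : G) • ((1 : G) : G ⧸ H) = ((1 : G) : G ⧸ H) := by
    rw [MulAction.Quotient.smul_coe, smul_eq_mul, mul_one]
    exact hone _ q.2
  set b : Quotient (MulAction.orbitRel (Subgroup.zpowers (q : G)) (G ⧸ H)) :=
    Quotient.mk _ ((1 : G) : G ⧸ H) with hb
  -- The transfer of `q` is a product over the orbits of `q` on `G ⧸ H`; only the fixed trivial
  -- coset contributes, and its factor is `q`.
  rw [MonoidHom.transfer_eq_prod_quotient_orbitRel_zpowers_quot, Finset.prod_eq_single b]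
  · have hbout : b.out = ((1 : G) : G ⧸ H) := by
      have h1 : (MulAction.orbitRel (Subgroup.zpowers (q : G)) (G ⧸ H)) b.out
          ((1 : G) : G ⧸ H) := Quotient.exact (Quotient.out_eq b)
      obtain ⟨⟨z, hz⟩, hz'⟩ := h1
      obtain ⟨n, rfl⟩ := Subgroup.mem_zpowers_iff.1 hz
      rw [← hz']
      change ((q : G) ^ n) • ((1 : G) : G ⧸ H) = _
      rw [MulAction.Quotient.smul_coe, smul_eq_mul, mul_one]
      exact hone _ (H.zpow_mem q.2 n)
    have hr : (b.out.out : G) ∈ H := by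
      have h2 : ((b.out.out : G) : G ⧸ H) = ((1 : G) : G ⧸ H) := by
        rw [QuotientGroup.out_eq', hbout]
      rw [eq_comm, QuotientGroup.eq] at h2
      simpa using h2
    have hper : Function.minimalPeriod ((q : G) • · : G ⧸ H → G ⧸ H) b.out = 1 := by
      rw [Function.minimalPeriod_eq_one_iff_isFixedPt, hbout]
      exact hfix
    apply Subtype.ext
    simp only [MonoidHom.id_apply, hper, pow_one]
    rw [mul_assoc, hHcomm _ q.2 _ hr, inv_mul_cancel_left]
  · intro c _ hc
    apply Subtype.ext
    -- The factor of any other orbit is a power of `q` conjugated into `H` by an element outside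
    -- `H`, hence trivial by malnormality.
    have hmem := QuotientGroup.out_conj_pow_minimalPeriod_mem H (q : G) c.out
    have hr : (c.out.out : G)⁻¹ ∉ H := fun hr => hc <| by
      rw [← Quotient.out_eq c, hb]
      congr 1
      rw [← QuotientGroup.out_eq' c.out]
      exact hone _ (by simpa using hr)
    have h1 := hH.malnormal _ hr _ (H.pow_mem q.2 _) (by rwa [inv_inv])
    simp only [MonoidHom.id_apply, h1]
    simp
  · simp

variable {H : Subgroup G} {φ : G →* H}

theorem apply_mul_mem_ker (hφ : ∀ q : H, φ q = q) (x : G) : x * ((φ x)⁻¹ : H) ∈ φ.ker := by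
  rw [MonoidHom.mem_ker, map_mul, hφ, mul_inv_cancel]

theorem eq_one_of_mem_ker_of_mem (hφ : ∀ q : H, φ q = q) {x : G} (hx : x ∈ φ.ker) (hxH : x ∈ H) :
    x = 1 := by
  have := hφ ⟨x, hxH⟩
  rw [MonoidHom.mem_ker.1 hx] at this
  exact (congrArg Subtype.val this).symm

theorem map_conj_eq (hHcomm : ∀ x ∈ H, ∀ y ∈ H, x * y = y * x) (g x : G) :
    φ (g * x * g⁻¹) = φ x := by
  apply Subtype.ext
  rw [map_mul, map_mul, map_inv, Subgroup.coe_mul, Subgroup.coe_mul,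
    hHcomm _ (φ g).2 _ (φ x).2, ← Subgroup.coe_mul, ← Subgroup.coe_mul, mul_inv_cancel_right]

theorem map_mul_comm (hHcomm : ∀ x ∈ H, ∀ y ∈ H, x * y = y * x) (x y : G) :
    φ (x * y) = φ (y * x) := by
  have := map_conj_eq (φ := φ) hHcomm x (y * x)
  rwa [← mul_assoc, mul_inv_cancel_right] at this

/-- With `q = φ b ≠ 1`, the map `n ↦ n q n⁻¹ q⁻¹` of the kernel to itself is injective: by
malnormality the centralizer of `q` lies in `H`, which meets the kernel trivially. By finiteness it
is surjective, so it reaches `b q⁻¹`. -/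
theorem exists_conj_apply [Finite G] (hH : IsFrobeniusComplement H) (hφ : ∀ q : H, φ q = q)
    (hHcomm : ∀ x ∈ H, ∀ y ∈ H, x * y = y * x) {b : G} (hb : b ∉ φ.ker) :
    ∃ n ∈ φ.ker, n * (φ b : G) * n⁻¹ = b := by
  have hne : (φ b : G) ≠ 1 := fun h => hb (MonoidHom.mem_ker.2 (Subtype.ext h))
  let F : φ.ker → φ.ker := fun n => ⟨n * (φ b : G) * (n : G)⁻¹ * ((φ b)⁻¹ : H), by
    rw [MonoidHom.mem_ker, map_mul, map_conj_eq hHcomm, hφ, hφ, mul_inv_cancel]⟩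
  have hF : Function.Injective F := by
    intro m n hmn
    have h1 : (m : G) * (φ b : G) * (m : G)⁻¹ = n * (φ b : G) * (n : G)⁻¹ :=
      mul_right_cancel (congrArg Subtype.val hmn)
    have h2 : ((n : G)⁻¹ * m) * (φ b : G) * ((n : G)⁻¹ * m)⁻¹ = φ b := by
      calc ((n : G)⁻¹ * m) * (φ b : G) * ((n : G)⁻¹ * m)⁻¹
          = (n : G)⁻¹ * ((m : G) * (φ b : G) * (m : G)⁻¹) * n := by group
        _ = φ b := by rw [h1]; group
    have h3 : (n : G)⁻¹ * m ∈ H := by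
      by_contra h
      exact hne (hH.malnormal _ h _ (φ b).2 (by rw [h2]; exact (φ b).2))
    have h4 := eq_one_of_mem_ker_of_mem hφ (mul_mem (inv_mem n.2) m.2) h3
    exact Subtype.ext (inv_mul_eq_one.1 h4).symm
  obtain ⟨n, hn⟩ := (Finite.injective_iff_surjective.1 hF) ⟨_, apply_mul_mem_ker hφ b⟩
  exact ⟨n, n.2, mul_right_cancel (congrArg Subtype.val hn)⟩

/-- Both elements are conjugate under the kernel to the same nontrivial element of `H`, whose
centralizer meets the kernel trivially. -/
theorem existsUnique_conj [Finite G] (hH : IsFrobeniusComplement H) (hφ : ∀ q : H, φ q = q)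
    (hHcomm : ∀ x ∈ H, ∀ y ∈ H, x * y = y * x) {a b : G} (ha : a ∉ φ.ker) (hab : φ a = φ b) :
    ∃! n, n ∈ φ.ker ∧ n * a * n⁻¹ = b := by
  have hb : b ∉ φ.ker := by rwa [MonoidHom.mem_ker, ← hab]
  obtain ⟨m, hm, hma⟩ := exists_conj_apply hH hφ hHcomm ha
  obtain ⟨n, hn, hnb⟩ := exists_conj_apply hH hφ hHcomm hb
  have hne : (φ a : G) ≠ 1 := fun h => ha (MonoidHom.mem_ker.2 (Subtype.ext h))
  refine ⟨n * m⁻¹, ⟨mul_mem hn (inv_mem hm), ?_⟩, ?_⟩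
  · rw [← hnb, ← hab]
    conv_lhs => rw [← hma]
    group
  · rintro t ⟨ht, hta⟩
    have h2 : (n⁻¹ * t * m) * (φ a : G) * (n⁻¹ * t * m)⁻¹ = φ a := by
      calc (n⁻¹ * t * m) * (φ a : G) * (n⁻¹ * t * m)⁻¹
          = n⁻¹ * (t * (m * φ a * m⁻¹) * t⁻¹) * n := by group
        _ = φ a := by
          rw [hma, hta]
          conv_lhs => rw [← hnb, ← hab]
          group
    have h3 : n⁻¹ * t * m ∈ H := by
      by_contra h
      exact hne (hH.malnormal _ h _ (φ a).2 (by rw [h2]; exact (φ a).2))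
    have h4 := eq_one_of_mem_ker_of_mem hφ (mul_mem (mul_mem (inv_mem hn) ht) hm) h3
    calc t = n * (n⁻¹ * t * m) * m⁻¹ := by group
      _ = n * m⁻¹ := by rw [h4, mul_one]

theorem isConj_iff_map_eq [Finite G] (hH : IsFrobeniusComplement H) (hφ : ∀ q : H, φ q = q)
    (hHcomm : ∀ x ∈ H, ∀ y ∈ H, x * y = y * x) {a b : G} (ha : a ∉ φ.ker) :
    IsConj a b ↔ φ a = φ b := by
  constructor
  · intro h
    obtain ⟨c, rfl⟩ := isConj_iff.1 h
    exact (map_conj_eq hHcomm c a).symm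
  · intro h
    obtain ⟨n, ⟨-, hn⟩, -⟩ := existsUnique_conj hH hφ hHcomm ha h
    exact isConj_iff.2 ⟨n, hn⟩

theorem frobeniusKernel_eq_ker [Finite G] (hH : IsFrobeniusComplement H) (hφ : ∀ q : H, φ q = q)
    (hHcomm : ∀ x ∈ H, ∀ y ∈ H, x * y = y * x) : frobeniusKernel H = (φ.ker : Set G) := by
  ext x
  constructor
  · rintro (hx | rfl)
    · by_contra hxN
      obtain ⟨n, -, hn⟩ := exists_conj_apply hH hφ hHcomm hxN
      exact hx n _ (φ x).2 hn.symm
    · exact one_mem _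
  · intro hx
    by_cases h1 : x = 1
    · exact Or.inr h1
    · refine Or.inl fun g y hy hxy => h1 ?_
      have h2 : φ x = ⟨y, hy⟩ := by rw [hxy, map_conj_eq hHcomm]; exact hφ ⟨y, hy⟩
      rw [MonoidHom.mem_ker.1 hx] at h2
      have h3 : (1 : G) = y := congrArg Subtype.val h2
      rw [hxy, ← h3]; group

/-- If `g` were outside the kernel, `a` and `1` would be two kernel elements conjugating `g` to
itself. -/
theorem mem_ker_of_conj_eq_self [Finite G] (hH : IsFrobeniusComplement H) (hφ : ∀ q : H, φ q = q)
    (hHcomm : ∀ x ∈ H, ∀ y ∈ H, x * y = y * x) {a g : G} (ha : a ∈ φ.ker) (ha1 : a ≠ 1)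
    (hga : g * a * g⁻¹ = a) : g ∈ φ.ker := by
  by_contra hg
  refine ha1 ((existsUnique_conj hH hφ hHcomm hg rfl).unique ⟨ha, ?_⟩ ⟨one_mem _, ?_⟩)
  · have : g * a = a * g := by rwa [mul_inv_eq_iff_eq_mul] at hga
    rw [← this]; group
  · group

theorem card_eq_card_mul_card_ker [Finite G] (hφ : ∀ q : H, φ q = q) :
    Nat.card G = Nat.card H * Nat.card φ.ker := by
  have h1 : Function.Surjective φ := fun q => ⟨q, hφ q⟩
  rw [Subgroup.card_eq_card_quotient_mul_card_subgroup φ.ker,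
    Nat.card_congr (QuotientGroup.quotientKerEquivOfSurjective φ h1).toEquiv]

theorem exists_mem_ker_ne_one (hH : IsFrobeniusComplement H) (hφ : ∀ q : H, φ q = q) :
    ∃ a ∈ φ.ker, a ≠ 1 := by
  by_contra! hall
  refine hH.ne_top ((Subgroup.eq_top_iff' H).2 fun x => ?_)
  have h1 := hall _ (apply_mul_mem_ker hφ x)
  rw [mul_eq_one_iff_eq_inv] at h1
  rw [h1]
  exact inv_mem (SetLike.coe_mem _)

/-- An element outside the kernel has a centralizer of order `|H|`. -/
theorem card_conj_eq [Finite G] (hH : IsFrobeniusComplement H) (hφ : ∀ q : H, φ q = q)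
    (hHcomm : ∀ x ∈ H, ∀ y ∈ H, x * y = y * x) {a b : G} (ha : a ∉ φ.ker) (hab : φ a = φ b) :
    Nat.card {g : G // g * a * g⁻¹ = b} = Nat.card H := by
  refine Nat.card_eq_of_bijective (fun g : {g : G // g * a * g⁻¹ = b} => φ g) ⟨?_, fun q => ?_⟩
  · rintro ⟨g, hg⟩ ⟨g', hg'⟩ hgg'
    have hgg' : φ g = φ g' := hgg'
    have hmem : ∀ s : G, φ g = φ s → s * (g : G)⁻¹ ∈ φ.ker := fun s hs => by
      rw [MonoidHom.mem_ker, map_mul, map_inv, hs, mul_inv_cancel]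
    have hb : b ∉ φ.ker := by rwa [MonoidHom.mem_ker, ← hab]
    have hconj : g' * g⁻¹ * b * (g' * g⁻¹)⁻¹ = b := by
      calc g' * g⁻¹ * b * (g' * g⁻¹)⁻¹ = g' * a * g'⁻¹ := by rw [← hg]; group
        _ = b := hg'
    have h1 := (existsUnique_conj hH hφ hHcomm hb rfl).unique
      ⟨hmem g' hgg', hconj⟩ ⟨one_mem _, by group⟩
    exact Subtype.ext (mul_inv_eq_one.1 h1).symm
  · have ha' : (q : G) * a * (q : G)⁻¹ ∉ φ.ker := by
      rwa [MonoidHom.mem_ker, map_conj_eq hHcomm]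
    obtain ⟨n, ⟨hn, hn'⟩, -⟩ := existsUnique_conj hH hφ hHcomm (b := b) ha'
      (by rw [map_conj_eq hHcomm, hab])
    refine ⟨⟨n * q, ?_⟩, ?_⟩
    · rw [← hn']; group
    · change φ (n * q) = q
      rw [map_mul, MonoidHom.mem_ker.1 hn, one_mul, hφ]

theorem card_isConj_of_notMem_ker [Finite G] (hH : IsFrobeniusComplement H)
    (hφ : ∀ q : H, φ q = q) (hHcomm : ∀ x ∈ H, ∀ y ∈ H, x * y = y * x) {a : G}
    (ha : a ∉ φ.ker) : Nat.card {y : G // IsConj a y} = Nat.card φ.ker := by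
  symm
  refine Nat.card_eq_of_bijective
    (fun n : φ.ker => (⟨n * a * (n : G)⁻¹, isConj_iff.2 ⟨n, rfl⟩⟩ : {y : G // IsConj a y}))
    ⟨fun m n hmn => ?_, fun y => ?_⟩
  · have hmn : (m : G) * a * (m : G)⁻¹ = n * a * (n : G)⁻¹ := congrArg Subtype.val hmn
    exact Subtype.ext ((existsUnique_conj hH hφ hHcomm ha
      (map_conj_eq hHcomm n a).symm).unique ⟨m.2, hmn⟩ ⟨n.2, rfl⟩)
  · obtain ⟨n, ⟨hn, hn'⟩, -⟩ := existsUnique_conj hH hφ hHcomm ha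
      ((isConj_iff_map_eq hH hφ hHcomm ha).1 y.2)
    exact ⟨⟨n, hn⟩, Subtype.ext hn'⟩

/-- `H` acts regularly on the class: the kernel part of a conjugator commutes with `a`, and the
centralizer of `a` lies in the kernel, which meets `H` trivially. -/
theorem card_isConj_of_mem_ker [Finite G] (hH : IsFrobeniusComplement H)
    (hφ : ∀ q : H, φ q = q) (hHcomm : ∀ x ∈ H, ∀ y ∈ H, x * y = y * x)
    (hNcomm : ∀ x ∈ φ.ker, ∀ y ∈ φ.ker, x * y = y * x) {a : G}
    (ha : a ∈ φ.ker) (ha1 : a ≠ 1) : Nat.card {y : G // IsConj a y} = Nat.card H := by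
  symm
  refine Nat.card_eq_of_bijective
    (fun q : H => (⟨q * a * (q : G)⁻¹, isConj_iff.2 ⟨q, rfl⟩⟩ : {y : G // IsConj a y}))
    ⟨fun p q hpq => ?_, fun y => ?_⟩
  · have hpq : (p : G) * a * (p : G)⁻¹ = q * a * (q : G)⁻¹ := congrArg Subtype.val hpq
    have h1 : ((q : G)⁻¹ * p) * a * ((q : G)⁻¹ * p)⁻¹ = a := by
      calc ((q : G)⁻¹ * p) * a * ((q : G)⁻¹ * p)⁻¹
          = (q : G)⁻¹ * ((p : G) * a * (p : G)⁻¹) * q := by group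
        _ = a := by rw [hpq]; group
    have h2 := eq_one_of_mem_ker_of_mem hφ (mem_ker_of_conj_eq_self hH hφ hHcomm ha ha1 h1)
      (mul_mem (inv_mem q.2) p.2)
    exact Subtype.ext (inv_mul_eq_one.1 h2).symm
  · obtain ⟨c, hc⟩ := isConj_iff.1 y.2
    refine ⟨φ c, Subtype.ext ?_⟩
    change (φ c : G) * a * (φ c : G)⁻¹ = y
    have hn : (φ c : G)⁻¹ * c ∈ φ.ker := by
      rw [MonoidHom.mem_ker, map_mul, map_inv, hφ, inv_mul_cancel]
    have h1 := hNcomm _ hn _ ha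
    rw [← hc]
    calc (φ c : G) * a * (φ c : G)⁻¹
        = φ c * (a * ((φ c : G)⁻¹ * c)) * c⁻¹ := by group
      _ = c * a * c⁻¹ := by rw [← h1]; group

/-- The class of a nontrivial kernel element has `|H|` elements, stays in the kernel and misses `1`.
-/
theorem card_lt_card_ker [Finite G] (hH : IsFrobeniusComplement H)
    (hφ : ∀ q : H, φ q = q) (hHcomm : ∀ x ∈ H, ∀ y ∈ H, x * y = y * x)
    (hNcomm : ∀ x ∈ φ.ker, ∀ y ∈ φ.ker, x * y = y * x) : Nat.card H < Nat.card φ.ker := by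
  obtain ⟨a, ha, ha1⟩ := exists_mem_ker_ne_one hH hφ
  rw [← card_isConj_of_mem_ker hH hφ hHcomm hNcomm ha ha1]
  refine Finite.card_subtype_lt (p := fun n : φ.ker => IsConj a n) (x := 1) ?_ |>.trans_le' ?_
  · intro h
    exact ha1 (isConj_one_left.1 h)
  · refine Nat.card_le_card_of_injective
      (fun y : {y : G // IsConj a y} => (⟨⟨y, ?_⟩, y.2⟩ : {n : φ.ker // IsConj a n})) ?_
    · obtain ⟨c, hc⟩ := isConj_iff.1 y.2
      rw [← hc, MonoidHom.mem_ker, map_conj_eq hHcomm]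
      exact MonoidHom.mem_ker.1 ha
    · intro y z hyz
      simpa [Subtype.ext_iff] using hyz

end FrobeniusGroups

/-! ### Conjugator counts and the coefficients of the diagonal. -/

section ConjugatorCount

variable {G : Type*} [Group G]

/-- The number of `g` conjugating `y` to `x⁻¹`. -/
noncomputable def conjugatorCount (x y : G) : ℕ :=
  Nat.card {g : G // g * y * g⁻¹ = x⁻¹}

theorem conjugatorCount_conj (g g' x y : G) :
    conjugatorCount (g * x * g⁻¹) (g' * y * g'⁻¹) = conjugatorCount x y := by
  refine Nat.card_congr (((Equiv.mulLeft g⁻¹).trans (Equiv.mulRight g')).subtypeEquiv fun t => ?_)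
  change t * (g' * y * g'⁻¹) * t⁻¹ = (g * x * g⁻¹)⁻¹ ↔ (g⁻¹ * t * g') * y * (g⁻¹ * t * g')⁻¹ = x⁻¹
  have h1 : (g⁻¹ * t * g') * y * (g⁻¹ * t * g')⁻¹ = g⁻¹ * (t * (g' * y * g'⁻¹) * t⁻¹) * g := by
    group
  rw [h1]
  constructor
  · intro h; rw [h]; group
  · intro h
    calc t * (g' * y * g'⁻¹) * t⁻¹ = g * (g⁻¹ * (t * (g' * y * g'⁻¹) * t⁻¹) * g) * g⁻¹ := by group
      _ = _ := by rw [h]; group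

theorem conjugatorCount_ne_zero_iff [Finite G] (x y : G) :
    conjugatorCount x y ≠ 0 ↔ IsConj x⁻¹ y := by
  rw [conjugatorCount, Nat.card_ne_zero, isConj_comm, isConj_iff, nonempty_subtype]
  exact and_iff_left inferInstance

theorem conjugatorCount_cast [Fintype G] [DecidableEq G] {R : Type*} [Semiring R] (x y : G) :
    (conjugatorCount x y : R) = ∑ g : G, if g * y * g⁻¹ = x⁻¹ then 1 else 0 := by
  rw [conjugatorCount, Nat.card_eq_fintype_card, Fintype.card_subtype, Finset.sum_boole]

theorem sum_conjugatorCount [Fintype G] :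
    ∑ x : G, ∑ y : G, (conjugatorCount x y : ℝ) = (Nat.card G : ℝ) ^ 2 := by
  classical
  have h : ∀ y : G, ∑ x : G, (conjugatorCount x y : ℝ) = Nat.card G := fun y => by
    simp_rw [conjugatorCount_cast]
    rw [Finset.sum_comm]
    have : ∀ g : G, (∑ x : G, if g * y * g⁻¹ = x⁻¹ then (1 : ℝ) else 0) = 1 := fun g => by
      simp_rw [eq_comm (a := g * y * g⁻¹), inv_eq_iff_eq_inv]
      simp
    simp [this]
  rw [Finset.sum_comm]
  simp_rw [h]
  simp [sq]

/-- For each fixed `g` both sums collapse to a single `z`, and the two values of `z` are conjugate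
by `g`. -/
theorem sum_coeff_mul_conjugatorCount [Fintype G] (a : Subalgebra.center ℂ (MonoidAlgebra ℂ G))
    (u v : G) :
    ∑ z, (a : MonoidAlgebra ℂ G).coeff z * (conjugatorCount (z⁻¹ * u) v : ℂ) =
      ∑ z, (a : MonoidAlgebra ℂ G).coeff z * (conjugatorCount u (v * z⁻¹) : ℂ) := by
  classical
  simp_rw [conjugatorCount_cast, Finset.mul_sum]
  rw [Finset.sum_comm]
  conv_rhs => rw [Finset.sum_comm]
  refine Finset.sum_congr rfl fun g _ => ?_
  have h1 : ∀ z : G, g * v * g⁻¹ = (z⁻¹ * u)⁻¹ ↔ z = u * (g * v * g⁻¹) := fun z => by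
    rw [mul_inv_rev, inv_inv, eq_comm, inv_mul_eq_iff_eq_mul]
  have h2 : ∀ z : G, g * (v * z⁻¹) * g⁻¹ = u⁻¹ ↔ z = g⁻¹ * u * g * v := fun z => by
    constructor
    · intro h
      have : u = (g * (v * z⁻¹) * g⁻¹)⁻¹ := by rw [h, inv_inv]
      rw [this]; group
    · rintro rfl; group
  simp_rw [h1, h2]
  simp only [mul_ite, mul_one, mul_zero, Finset.sum_ite_eq', Finset.mem_univ, if_true]
  rw [← coeff_conj_of_mem_center a g (g⁻¹ * u * g * v)]
  congr 1
  group

variable {H : Subgroup G} {φ : G →* H}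

/-- The coefficients of the diagonal element. -/
noncomputable def frobeniusDiagonalCoeff (φ : G →* H) (x y : G) : ℝ :=
  open Classical in
  ((Nat.card H : ℝ) ^ 2 * conjugatorCount x y -
    ((Nat.card H : ℝ) ^ 2 - 1) * Nat.card H * (if x * y ∈ φ.ker then 1 else 0)) /
    (Nat.card G : ℝ) ^ 2

theorem frobeniusDiagonalCoeff_conj (hHcomm : ∀ x ∈ H, ∀ y ∈ H, x * y = y * x) (g g' x y : G) :
    frobeniusDiagonalCoeff φ (g * x * g⁻¹) (g' * y * g'⁻¹) = frobeniusDiagonalCoeff φ x y := by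
  have h : (g * x * g⁻¹) * (g' * y * g'⁻¹) ∈ φ.ker ↔ x * y ∈ φ.ker := by
    rw [MonoidHom.mem_ker, MonoidHom.mem_ker, map_mul, map_conj_eq hHcomm, map_conj_eq hHcomm,
      map_mul]
  by_cases hxy : x * y ∈ φ.ker
  · simp only [frobeniusDiagonalCoeff, conjugatorCount_conj, h.2 hxy, hxy]
  · simp only [frobeniusDiagonalCoeff, conjugatorCount_conj, mt h.1 hxy, hxy]

end ConjugatorCount

/-! ### Verification of the diagonal identities and evaluation of its norm. -/

section FrobeniusSums

variable {G : Type*} [Group G] [Fintype G] {H : Subgroup G} {φ : G →* H}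

open Classical in
theorem sum_indicator_ker : ∑ x : G, (if x ∈ φ.ker then (1 : ℝ) else 0) = Nat.card φ.ker := by
  rw [Finset.sum_boole, ← Fintype.card_subtype, ← Nat.card_eq_fintype_card]

open Classical in
theorem sum_indicator_mul_mem_ker :
    ∑ x : G, ∑ y : G, (if x * y ∈ φ.ker then (1 : ℝ) else 0) =
      Nat.card G * Nat.card φ.ker := by
  have : ∀ x : G, ∑ y : G, (if x * y ∈ φ.ker then (1 : ℝ) else 0) = Nat.card φ.ker := fun x => by
    rw [← sum_indicator_ker]
    exact Fintype.sum_equiv (Equiv.mulLeft x) _ _ fun y => rfl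
  simp_rw [this]
  simp

theorem conjugatorCount_eq_zero (hHcomm : ∀ x ∈ H, ∀ y ∈ H, x * y = y * x) {x y : G}
    (hxy : x * y ∉ φ.ker) : conjugatorCount x y = 0 := by
  by_contra h
  rw [← ne_eq, conjugatorCount_ne_zero_iff, isConj_iff] at h
  obtain ⟨c, rfl⟩ := h
  refine hxy ?_
  rw [MonoidHom.mem_ker, map_mul, map_conj_eq hHcomm, map_inv, mul_inv_cancel]

/-- This bound fixes the sign of the diagonal coefficients. For `y` in the abelian kernel a whole
coset of the kernel conjugates `y` to `x⁻¹`, and the kernel is larger than `H`; otherwise the count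
is exactly `|H|`. -/
theorem card_le_conjugatorCount (hH : IsFrobeniusComplement H)
    (hφ : ∀ q : H, φ q = q) (hHcomm : ∀ x ∈ H, ∀ y ∈ H, x * y = y * x)
    (hNcomm : ∀ x ∈ φ.ker, ∀ y ∈ φ.ker, x * y = y * x) {x y : G}
    (hxy : IsConj x⁻¹ y) : Nat.card H ≤ conjugatorCount x y := by
  obtain ⟨g, hg⟩ := isConj_iff.1 hxy.symm
  by_cases hy : y ∈ φ.ker
  · refine (card_lt_card_ker hH hφ hHcomm hNcomm).le.trans ?_
    refine Nat.card_le_card_of_injective (fun n : φ.ker => ⟨g * n, ?_⟩) ?_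
    · calc g * n * y * (g * n)⁻¹ = g * (n * y) * (n : G)⁻¹ * g⁻¹ := by group
        _ = x⁻¹ := by rw [hNcomm _ n.2 _ hy, ← hg]; group
    · intro m n hmn
      exact Subtype.ext (mul_left_cancel (congrArg Subtype.val hmn))
  · rw [conjugatorCount, card_conj_eq hH hφ hHcomm hy]
    rw [← hg, map_conj_eq hHcomm]

open Classical in
theorem sum_isConj (hH : IsFrobeniusComplement H)
    (hφ : ∀ q : H, φ q = q) (hHcomm : ∀ x ∈ H, ∀ y ∈ H, x * y = y * x)
    (hNcomm : ∀ x ∈ φ.ker, ∀ y ∈ φ.ker, x * y = y * x) :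
    ∑ x : G, ∑ y : G, (if IsConj x⁻¹ y then (1 : ℝ) else 0) =
      1 + (Nat.card φ.ker - 1) * Nat.card H +
        (Nat.card G - Nat.card φ.ker) * Nat.card φ.ker := by
  -- The class sizes are 1 at the identity, `|H|` on the rest of the kernel and `|ker φ|` outside
  -- it, written as one combination of indicators.
  have h1 : ∀ x : G, ∑ y : G, (if IsConj x y then (1 : ℝ) else 0) =
      (if x = 1 then (1 : ℝ) else 0) * (1 - Nat.card H) +
      (if x ∈ φ.ker then (1 : ℝ) else 0) * (Nat.card H - Nat.card φ.ker) + Nat.card φ.ker := by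
    intro x
    rw [Finset.sum_boole, ← Fintype.card_subtype, ← Nat.card_eq_fintype_card]
    by_cases hx : x ∈ φ.ker
    · by_cases hx1 : x = 1
      · subst hx1
        simp
      · rw [card_isConj_of_mem_ker hH hφ hHcomm hNcomm hx hx1]
        simp only [hx, hx1, if_true, if_false]
        ring
    · have hx1 : x ≠ 1 := fun h => hx (h ▸ one_mem _)
      rw [card_isConj_of_notMem_ker hH hφ hHcomm hx]
      simp only [hx, hx1, if_false]
      ring
  rw [Fintype.sum_equiv (Equiv.inv G) (fun x => ∑ y : G, (if IsConj x⁻¹ y then (1 : ℝ) else 0))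
    (fun x => ∑ y : G, (if IsConj x y then (1 : ℝ) else 0)) fun x => rfl]
  simp_rw [h1]
  rw [Finset.sum_add_distrib, Finset.sum_add_distrib, ← Finset.sum_mul, ← Finset.sum_mul,
    sum_indicator_ker]
  simp
  ring

open Classical in
-- For `g` in the kernel commutativity reduces the equation to `w = 1`. For other `g` it says that
-- `x` conjugates `g⁻¹` to `w g⁻¹`, which has exactly one solution in the kernel.
theorem sum_indicator_commutator (hH : IsFrobeniusComplement H)
    (hφ : ∀ q : H, φ q = q) (hHcomm : ∀ x ∈ H, ∀ y ∈ H, x * y = y * x)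
    (hNcomm : ∀ x ∈ φ.ker, ∀ y ∈ φ.ker, x * y = y * x) {w : G} (hw : w ∈ φ.ker) (g : G) :
    ∑ x : G, (if x ∈ φ.ker ∧ g * (x⁻¹ * w) * g⁻¹ = x⁻¹ then (1 : ℝ) else 0) =
      1 + (if g ∈ φ.ker then (1 : ℝ) else 0) *
        (Nat.card φ.ker * (if w = 1 then 1 else 0) - 1) := by
  by_cases hg : g ∈ φ.ker
  · have h1 : ∀ x : G, x ∈ φ.ker ∧ g * (x⁻¹ * w) * g⁻¹ = x⁻¹ ↔ x ∈ φ.ker ∧ w = 1 := fun x => by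
      refine and_congr_right fun hx => ?_
      rw [hNcomm g hg _ (mul_mem (inv_mem hx) hw), mul_inv_cancel_right, mul_eq_left]
    simp_rw [h1]
    by_cases hw1 : w = 1
    · simp only [hw1, and_true, sum_indicator_ker, hg, if_true]
      ring
    · simp [hw1, hg]
  · obtain ⟨n, ⟨hn, hn'⟩, huniq⟩ := existsUnique_conj hH hφ hHcomm (a := g⁻¹) (b := w * g⁻¹)
      (by simpa using hg) (by rw [map_mul, MonoidHom.mem_ker.1 hw, one_mul])
    have h1 : ∀ x : G, x ∈ φ.ker ∧ g * (x⁻¹ * w) * g⁻¹ = x⁻¹ ↔ x = n := fun x => by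
      have h2 : g * (x⁻¹ * w) * g⁻¹ = x⁻¹ ↔ x * g⁻¹ * x⁻¹ = w * g⁻¹ := by
        constructor
        · intro h
          calc x * g⁻¹ * x⁻¹ = x * g⁻¹ * (g * (x⁻¹ * w) * g⁻¹) := by rw [h]
            _ = w * g⁻¹ := by group
        · intro h
          calc g * (x⁻¹ * w) * g⁻¹ = g * x⁻¹ * (w * g⁻¹) := by group
            _ = x⁻¹ := by rw [← h]; group
      rw [h2]
      exact ⟨huniq x, by rintro rfl; exact ⟨hn, hn'⟩⟩
    simp_rw [h1]
    simp [hg]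

open Classical in
theorem sum_conjugatorCount_inv_mul (hH : IsFrobeniusComplement H)
    (hφ : ∀ q : H, φ q = q) (hHcomm : ∀ x ∈ H, ∀ y ∈ H, x * y = y * x)
    (hNcomm : ∀ x ∈ φ.ker, ∀ y ∈ φ.ker, x * y = y * x) (w : G) :
    ∑ x : G, (conjugatorCount x (x⁻¹ * w) : ℝ) =
      (Nat.card φ.ker : ℝ) ^ 2 * (if w = 1 then 1 else 0) +
      Nat.card φ.ker * ((Nat.card H : ℝ) ^ 2 - 1) * (if w ∈ φ.ker then 1 else 0) := by
  have hG : (Nat.card G : ℝ) = Nat.card H * Nat.card φ.ker := by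
    exact_mod_cast card_eq_card_mul_card_ker hφ
  by_cases hw : w ∈ φ.ker
  · have h1 : ∀ x : G, (conjugatorCount x (x⁻¹ * w) : ℝ) =
        Nat.card H * (1 - if x ∈ φ.ker then (1 : ℝ) else 0) +
        ∑ g : G, (if x ∈ φ.ker ∧ g * (x⁻¹ * w) * g⁻¹ = x⁻¹ then (1 : ℝ) else 0) := fun x => by
      by_cases hx : x ∈ φ.ker
      · simp only [hx, true_and, if_true, conjugatorCount_cast]
        ring
      · rw [conjugatorCount, card_conj_eq hH hφ hHcomm]
        · simp [hx]
        · rwa [Subgroup.mul_mem_cancel_right _ hw, inv_mem_iff]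
        · rw [map_mul, MonoidHom.mem_ker.1 hw, mul_one]
    simp_rw [h1]
    rw [Finset.sum_add_distrib, Finset.sum_comm (γ := G)]
    simp_rw [sum_indicator_commutator hH hφ hHcomm hNcomm hw]
    rw [← Finset.mul_sum, Finset.sum_sub_distrib, Finset.sum_add_distrib, ← Finset.sum_mul,
      sum_indicator_ker]
    simp only [Finset.sum_const, Finset.card_univ, nsmul_eq_mul, mul_one, hw, if_true,
      ← Nat.card_eq_fintype_card (α := G), hG]
    ring
  · have hw1 : w ≠ 1 := fun h => hw (h ▸ one_mem _)
    simp only [hw, hw1, if_false, mul_zero, add_zero]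
    refine Finset.sum_eq_zero fun x _ => ?_
    rw [conjugatorCount_eq_zero (φ := φ) hHcomm (by rwa [mul_inv_cancel_left]), Nat.cast_zero]

theorem isDiagonalElement_frobeniusDiagonalCoeff (hH : IsFrobeniusComplement H)
    (hφ : ∀ q : H, φ q = q) (hHcomm : ∀ x ∈ H, ∀ y ∈ H, x * y = y * x)
    (hNcomm : ∀ x ∈ φ.ker, ∀ y ∈ φ.ker, x * y = y * x) :
    IsDiagonalElement (A := Subalgebra.center ℂ (MonoidAlgebra ℂ G))
      (centerTensorOfCoeff fun x y => (frobeniusDiagonalCoeff φ x y : ℂ)) := by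
  classical
  have hcoeff := centerTensorCoeff_centerTensorOfCoeff
    (m := fun x y => (frobeniusDiagonalCoeff φ x y : ℂ))
    fun g g' x y => by rw [frobeniusDiagonalCoeff_conj hHcomm]
  refine isDiagonalElement_of_coeff (fun a u v => ?_) fun w => ?_
  -- The indicator part commutes with `a` term by term, because `φ` has abelian image.
  · have hmem : ∀ z : G, z⁻¹ * u * v ∈ φ.ker ↔ u * (v * z⁻¹) ∈ φ.ker := fun z => by
      rw [MonoidHom.mem_ker, MonoidHom.mem_ker, mul_assoc, map_mul_comm hHcomm, mul_assoc]
    simp_rw [hcoeff, frobeniusDiagonalCoeff, hmem]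
    push_cast
    have hsplit : ∀ c A n B d : ℂ, c * ((A * n - B) / d) = A / d * (c * n) - c * (B / d) :=
      fun c A n B d => by ring
    simp_rw [hsplit]
    rw [Finset.sum_sub_distrib, Finset.sum_sub_distrib, ← Finset.mul_sum, ← Finset.mul_sum,
      sum_coeff_mul_conjugatorCount]
  · have hG : (Nat.card G : ℝ) = Nat.card H * Nat.card φ.ker := by
      exact_mod_cast card_eq_card_mul_card_ker hφ
    have hH0 : (Nat.card H : ℝ) ≠ 0 := by exact_mod_cast Nat.card_pos.ne'
    have hN0 : (Nat.card φ.ker : ℝ) ≠ 0 := by exact_mod_cast Nat.card_pos.ne'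
    have h1 : ∑ x, frobeniusDiagonalCoeff φ x (x⁻¹ * w) = if w = 1 then 1 else 0 := by
      simp_rw [frobeniusDiagonalCoeff]
      rw [← Finset.sum_div, Finset.sum_sub_distrib, ← Finset.mul_sum,
        sum_conjugatorCount_inv_mul hH hφ hHcomm hNcomm]
      simp only [mul_inv_cancel_left, Finset.sum_const, Finset.card_univ, nsmul_eq_mul,
        ← Nat.card_eq_fintype_card (α := G), hG]
      field_simp
      ring
    simp_rw [hcoeff]
    rw [← Complex.ofReal_sum, h1]
    split_ifs <;> simp

open Classical in
-- On conjugate pairs `h² c ≥ h³ > (h² - 1) h`, so the numerator is positive; elsewhere `c = 0` and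
-- only the subtracted term remains. The last term corrects the sign on conjugate pairs, all of
-- which satisfy `xy ∈ ker φ`.
theorem abs_frobeniusDiagonalCoeff (hH : IsFrobeniusComplement H)
    (hφ : ∀ q : H, φ q = q) (hHcomm : ∀ x ∈ H, ∀ y ∈ H, x * y = y * x)
    (hNcomm : ∀ x ∈ φ.ker, ∀ y ∈ φ.ker, x * y = y * x) (x y : G) :
    |frobeniusDiagonalCoeff φ x y| =
      ((Nat.card H : ℝ) ^ 2 * conjugatorCount x y +
        ((Nat.card H : ℝ) ^ 2 - 1) * Nat.card H * (if x * y ∈ φ.ker then 1 else 0) -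
        2 * (((Nat.card H : ℝ) ^ 2 - 1) * Nat.card H) * (if IsConj x⁻¹ y then 1 else 0)) /
        (Nat.card G : ℝ) ^ 2 := by
  have hH1 : (1 : ℝ) ≤ Nat.card H := by exact_mod_cast Nat.card_pos
  rw [frobeniusDiagonalCoeff, abs_div, abs_of_nonneg (a := (Nat.card G : ℝ) ^ 2) (by positivity)]
  congr 1
  have hpos : 0 ≤ ((Nat.card H : ℝ) ^ 2 - 1) * Nat.card H := by nlinarith
  by_cases hc : IsConj x⁻¹ y
  · have h1 : x * y ∈ φ.ker := by
      by_contra h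
      exact (conjugatorCount_ne_zero_iff x y).2 hc (conjugatorCount_eq_zero hHcomm h)
    have h2 : (Nat.card H : ℝ) ≤ conjugatorCount x y := by
      exact_mod_cast card_le_conjugatorCount hH hφ hHcomm hNcomm hc
    simp only [h1, hc, if_true, mul_one]
    rw [abs_of_nonneg]
    · ring
    · have : (Nat.card H : ℝ) ^ 2 * Nat.card H ≤ (Nat.card H : ℝ) ^ 2 * conjugatorCount x y := by
        gcongr
      linarith
  · have h1 : conjugatorCount x y = 0 := by
      by_contra h
      exact hc ((conjugatorCount_ne_zero_iff x y).1 h)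
    simp only [h1, hc, if_false, Nat.cast_zero, mul_zero, zero_sub, zero_add, sub_zero, abs_neg]
    exact abs_of_nonneg (mul_nonneg hpos (by split_ifs <;> norm_num))

theorem sum_abs_frobeniusDiagonalCoeff (hH : IsFrobeniusComplement H)
    (hφ : ∀ q : H, φ q = q) (hHcomm : ∀ x ∈ H, ∀ y ∈ H, x * y = y * x)
    (hNcomm : ∀ x ∈ φ.ker, ∀ y ∈ φ.ker, x * y = y * x) :
    ∑ x : G, ∑ y : G, |frobeniusDiagonalCoeff φ x y| =
      1 + 2 * (((Nat.card H : ℝ) ^ 2 - 1) / Nat.card H) *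
        (1 - ((Nat.card H : ℝ) - 1) / Nat.card φ.ker) * (1 - 1 / (Nat.card φ.ker : ℝ)) := by
  classical
  have hG : (Nat.card G : ℝ) = Nat.card H * Nat.card φ.ker := by
    exact_mod_cast card_eq_card_mul_card_ker hφ
  have hH0 : (Nat.card H : ℝ) ≠ 0 := by exact_mod_cast Nat.card_pos.ne'
  have hN0 : (Nat.card φ.ker : ℝ) ≠ 0 := by exact_mod_cast Nat.card_pos.ne'
  simp_rw [abs_frobeniusDiagonalCoeff hH hφ hHcomm hNcomm, ← Finset.sum_div,
    Finset.sum_sub_distrib, Finset.sum_add_distrib, ← Finset.mul_sum]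
  rw [sum_conjugatorCount, sum_indicator_mul_mem_ker, sum_isConj hH hφ hHcomm hNcomm, hG]
  field_simp
  ring

end FrobeniusSums

theorem theorem3p3 {G : Type*} [Group G] [Finite G] (H : Subgroup G)
    (hH : IsFrobeniusComplement H)
    (hHcomm : ∀ x ∈ H, ∀ y ∈ H, x * y = y * x)
    (hKcomm : ∀ x ∈ frobeniusKernel H, ∀ y ∈ frobeniusKernel H, x * y = y * x)
    (h k : ℕ) (hh : Nat.card H = h) (hk : Nat.card (frobeniusKernel H) = k) :
    amzl G = 1 + 2 * (((h : ℝ) ^ 2 - 1) / h) * (1 - ((h : ℝ) - 1) / k) * (1 - 1 / (k : ℝ)) := by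
  have : Fintype G := Fintype.ofFinite G
  obtain ⟨φ, hφ⟩ := hH.exists_retraction hHcomm
  rw [frobeniusKernel_eq_ker hH hφ hHcomm] at hk hKcomm
  have hcoeff := centerTensorCoeff_centerTensorOfCoeff
    (m := fun x y => (frobeniusDiagonalCoeff φ x y : ℂ))
    fun g g' x y => by rw [frobeniusDiagonalCoeff_conj hHcomm]
  rw [amzl_eq_sum_of_isDiagonalElement
    (isDiagonalElement_frobeniusDiagonalCoeff hH hφ hHcomm hKcomm), Fintype.sum_prod_type]
  simp_rw [hcoeff, Complex.norm_real, Real.norm_eq_abs]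
  rw [sum_abs_frobeniusDiagonalCoeff hH hφ hHcomm hKcomm]
  subst hh hk
  rfl
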